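/- Let $d\in\mathbb N$, $d\ge 1$, $\mathbb D=\{2^j: j\in\mathbb N_0\}$, and for $0<p<\infty$ let $\mathcal G_p(\mathbb D)$ be the set of all $\varphi:\mathbb D\to(0,\infty)$ with $$1\le \frac{\varphi(2^k)}{\varphi(2^j)}\le 2^{(k-j)d/p},\qquad j\le k,\ j,k\in\mathbb N_0 .$$ Put $r_\varphi=\sup\{p>0:\varphi\in\mathcal G_p(\mathbb D)\}\in(0,\infty]$. With $Q_{j,m}=2^{-j}([0,1)^d+m)$, $j\in\mathbb Z$, $m\in\mathbb Z^d$, let $m_{\varphi,p}$ be the space of all complex sequences $\lambda=\{\lambda_k\}_{k\in\mathbb Z^d}$ with $$\|\lambda\,|\,m_{\varphi,p}\|=\sup_{j\in\mathbb N_0,\;m\in\mathbb Z^d}\frac{\varphi(2^j)}{|Q_{-j,m}|^{1/p}}\Big(\sum_{k:\,Q_{0,k}\subset Q_{-j,m}}|\lambda_k|^p\Big)^{1/p}<\infty .$$ A bounded linear operator $T:X\to Y$ between quasi-Banach spaces is called strictly singular if $\inf\{\|Tx|Y\|: x\in Z,\ \|x|X\|=1\}=0$ for each infinite-dimensional linear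 subspace $Z\subset X$. **Theorem.** Let $0<p_i<\infty$, $\varphi_i\in\mathcal G_{p_i}(\mathbb D)$, $\varphi_i(1)=1$ and $\sup_{k\in\mathbb N_0}\varphi_i(2^k)=\infty$, $i=1,2$, and assume $$\sup_{j\in\mathbb N_0}\frac{\varphi_2(2^j)}{\varphi_1(2^j)^{\varrho}}<\infty,\qquad \varrho=\min\Big\{1,\frac{p_1}{p_2}\Big\}.$$ Then $m_{\varphi_1,p_1}\subset m_{\varphi_2,p_2}$ and the embedding $\mathrm{id}:m_{\varphi_1,p_1}\to m_{\varphi_2,p_2}$ is continuous. For $i=1,2$, the limit $\lim_{\nu\to\infty}2^{-\nu d/p_i}\varphi_i(2^\nu)$ is positive if, and only if, $m_{\varphi_i,p_i}=\ell_{p_i}(\mathbb Z^d)$ in the sense of equivalent quasi-norms. Moreover: (i) Let $\lim_{\nu\to\infty}2^{-\nu d/p_2}\varphi_2(2^\nu)=0$. If $\lim_{\nu\to\infty}2^{-\nu d/p_1}\varphi_1(2^\nu)>0$, and if, in the case $p_1=p_2=r_{\varphi_2}$, in addition $p_i\ge 1$, $i=1,2$, then $\mathrm{id}$ is strictly singular.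 Conversely, if $\mathrm{id}$ is strictly singular, then $\lim_{\nu\to\infty}2^{-\nu d/p_1}\varphi_1(2^\nu)>0$, that is, $m_{\varphi_1,p_1}=\ell_{p_1}$. (ii) Let $\lim_{\nu\to\infty}2^{-\nu d/p_2}\varphi_2(2^\nu)>0$, that is, $m_{\varphi_2,p_2}=\ell_{p_2}$. Then $\mathrm{id}$ is strictly singular if, and only if, $\lim_{\nu\to\infty}2^{-\nu d/p_1}\varphi_1(2^\nu)>0$ (that is, $m_{\varphi_1,p_1}=\ell_{p_1}$) and $p_1<p_2$. -/

import Mathlib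

open Filter Topology
open scoped ENNReal

/-- The dyadic cube `Q_{j,k} = 2^{-j} ([0,1)^d + k)`, for `j ∈ ℤ` and `k ∈ ℤ^d`. -/
def dyadicCube {d : ℕ} (j : ℤ) (k : Fin d → ℤ) : Set (Fin d → ℝ) :=
  {x | ∀ i, (2 : ℝ) ^ (-j) * (k i : ℝ) ≤ x i ∧ x i < (2 : ℝ) ^ (-j) * ((k i : ℝ) + 1)}

/-- The finite set of all `k ∈ ℤ^d` with `Q_{0,k} ⊆ Q_{-j,m}`, for `j ∈ ℕ` and `m ∈ ℤ^d`
(see `mem_cubeIndex_iff`). -/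
noncomputable def cubeIndex {d : ℕ} (j : ℕ) (m : Fin d → ℤ) : Finset (Fin d → ℤ) :=
  Fintype.piFinset fun i => Finset.Ico (2 ^ j * m i) (2 ^ j * (m i + 1))

theorem mem_cubeIndex_iff {d : ℕ} (j : ℕ) (m k : Fin d → ℤ) :
    k ∈ cubeIndex j m ↔ dyadicCube 0 k ⊆ dyadicCube (-(j : ℤ)) m := by
  simp only [cubeIndex, Fintype.mem_piFinset, Finset.mem_Ico, dyadicCube, Set.subset_def,
    Set.mem_ofPred_eq, neg_neg, zpow_natCast, neg_zero, zpow_zero, one_mul]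
  constructor
  · intro h x hx i
    obtain ⟨h1, h2⟩ := h i
    obtain ⟨h3, h4⟩ := hx i
    have h1' : (2 : ℝ) ^ j * (m i : ℝ) ≤ (k i : ℝ) := by exact_mod_cast h1
    have h2' : (k i : ℝ) + 1 ≤ (2 : ℝ) ^ j * ((m i : ℝ) + 1) := by
      exact_mod_cast Int.add_one_le_iff.mpr h2
    exact ⟨h1'.trans h3, h4.trans_le h2'⟩
  · intro h i
    obtain ⟨h1, h2⟩ := h (fun i => (k i : ℝ)) (fun i => ⟨le_rfl, lt_add_one _⟩) i
    exact ⟨by exact_mod_cast h1, by exact_mod_cast h2⟩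

/-- The class `𝒢_p(𝔻)`, `𝔻 = {2^j : j ∈ ℕ}`. A function on `𝔻` is given by a function on `ℝ`, of
which only the values at the points `2^j` are ever used. -/
def MemG (d : ℕ) (p : ℝ) (φ : ℝ → ℝ) : Prop :=
  (∀ j : ℕ, 0 < φ (2 ^ j)) ∧
    ∀ j k : ℕ, j ≤ k →
      1 ≤ φ (2 ^ k) / φ (2 ^ j) ∧
        φ (2 ^ k) / φ (2 ^ j) ≤ (2 : ℝ) ^ (((k : ℝ) - (j : ℝ)) * ((d : ℝ) / p))

/-- The index `r_φ = sup {p > 0 : φ ∈ 𝒢_p(𝔻)} ∈ [0,∞]`. -/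
noncomputable def rIndex (d : ℕ) (φ : ℝ → ℝ) : ℝ≥0∞ :=
  ⨆ (p : ℝ) (_ : 0 < p ∧ MemG d p φ), ENNReal.ofReal p

/-- The term `φ(ℓ(Q)) |Q|^{-1/p} (∑_{k : Q_{0,k} ⊆ Q} |a_k|^p)^{1/p}` for the cube
`Q = Q_{-j,m}`, with `ℓ(Q) = 2^j` and `|Q| = (2^j)^d`. -/
noncomputable def morreyTerm {d : ℕ} (p : ℝ) (φ : ℝ → ℝ) (a : (Fin d → ℤ) → ℂ) (j : ℕ)
    (m : Fin d → ℤ) : ℝ :=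
  φ (2 ^ j) / (((2 : ℝ) ^ j) ^ d) ^ (1 / p) * (∑ k ∈ cubeIndex j m, ‖a k‖ ^ p) ^ (1 / p)

/-- The quasi-norm `‖a | m_{φ,p}‖`, the supremum of all `morreyTerm`s (used only for sequences for
which they are bounded, that is, for `a ∈ m_{φ,p}`). -/
noncomputable def morreyNorm {d : ℕ} (p : ℝ) (φ : ℝ → ℝ) (a : (Fin d → ℤ) → ℂ) : ℝ :=
  ⨆ q : ℕ × (Fin d → ℤ), morreyTerm p φ a q.1 q.2

theorem morreyTerm_smul {d : ℕ} {p : ℝ} (hp : 0 < p) (φ : ℝ → ℝ) (c : ℂ)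
    (a : (Fin d → ℤ) → ℂ) (j : ℕ) (m : Fin d → ℤ) :
    morreyTerm p φ (c • a) j m = ‖c‖ * morreyTerm p φ a j m := by
  have h : ∑ k ∈ cubeIndex j m, ‖(c • a) k‖ ^ p
      = ‖c‖ ^ p * ∑ k ∈ cubeIndex j m, ‖a k‖ ^ p := by
    rw [Finset.mul_sum]
    refine Finset.sum_congr rfl fun k _ => ?_
    rw [Pi.smul_apply, norm_smul, Real.mul_rpow (norm_nonneg _) (norm_nonneg _)]
  unfold morreyTerm
  rw [h, Real.mul_rpow (by positivity) (by positivity), ← Real.rpow_mul (norm_nonneg _),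
    mul_one_div_cancel hp.ne', Real.rpow_one]
  ring

theorem add_rpow_le_two_rpow {s x y : ℝ} (hs : 0 ≤ s) (hx : 0 ≤ x) (hy : 0 ≤ y) :
    (x + y) ^ s ≤ 2 ^ s * (x ^ s + y ^ s) := by
  have hx' := Real.rpow_nonneg hx s
  have hy' := Real.rpow_nonneg hy s
  rcases le_total x y with h | h
  · calc (x + y) ^ s ≤ (2 * y) ^ s := Real.rpow_le_rpow (by positivity) (by linarith) hs
      _ = 2 ^ s * y ^ s := Real.mul_rpow (by norm_num) hy
      _ ≤ 2 ^ s * (x ^ s + y ^ s) := by gcongr; linarith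
  · calc (x + y) ^ s ≤ (2 * x) ^ s := Real.rpow_le_rpow (by positivity) (by linarith) hs
      _ = 2 ^ s * x ^ s := Real.mul_rpow (by norm_num) hx
      _ ≤ 2 ^ s * (x ^ s + y ^ s) := by gcongr; linarith

theorem morreySum_add_le {d : ℕ} {p : ℝ} (hp : 0 < p) (a b : (Fin d → ℤ) → ℂ)
    (s : Finset (Fin d → ℤ)) :
    (∑ k ∈ s, ‖(a + b) k‖ ^ p) ^ (1 / p)
      ≤ 2 * 2 ^ (1 / p) * ((∑ k ∈ s, ‖a k‖ ^ p) ^ (1 / p) + (∑ k ∈ s, ‖b k‖ ^ p) ^ (1 / p)) := by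
  have hA : 0 ≤ ∑ k ∈ s, ‖a k‖ ^ p := Finset.sum_nonneg fun _ _ => by positivity
  have hB : 0 ≤ ∑ k ∈ s, ‖b k‖ ^ p := Finset.sum_nonneg fun _ _ => by positivity
  have h1 : ∑ k ∈ s, ‖(a + b) k‖ ^ p
      ≤ 2 ^ p * (∑ k ∈ s, ‖a k‖ ^ p + ∑ k ∈ s, ‖b k‖ ^ p) := by
    rw [← Finset.sum_add_distrib, Finset.mul_sum]
    refine Finset.sum_le_sum fun k _ => ?_
    refine le_trans (Real.rpow_le_rpow (norm_nonneg _) (norm_add_le (a k) (b k)) hp.le) ?_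
    exact add_rpow_le_two_rpow hp.le (norm_nonneg _) (norm_nonneg _)
  calc (∑ k ∈ s, ‖(a + b) k‖ ^ p) ^ (1 / p)
      ≤ (2 ^ p * (∑ k ∈ s, ‖a k‖ ^ p + ∑ k ∈ s, ‖b k‖ ^ p)) ^ (1 / p) :=
        Real.rpow_le_rpow (Finset.sum_nonneg fun _ _ => by positivity) h1 (by positivity)
    _ = 2 * (∑ k ∈ s, ‖a k‖ ^ p + ∑ k ∈ s, ‖b k‖ ^ p) ^ (1 / p) := by
        rw [Real.mul_rpow (by positivity) (by positivity), ← Real.rpow_mul (by norm_num),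
          mul_one_div_cancel hp.ne', Real.rpow_one]
    _ ≤ 2 * (2 ^ (1 / p) *
          ((∑ k ∈ s, ‖a k‖ ^ p) ^ (1 / p) + (∑ k ∈ s, ‖b k‖ ^ p) ^ (1 / p))) := by
        gcongr
        exact add_rpow_le_two_rpow (by positivity) hA hB
    _ = _ := by ring

theorem morreyTerm_add_le {d : ℕ} {p : ℝ} (hp : 0 < p) (φ : ℝ → ℝ) (a b : (Fin d → ℤ) → ℂ)
    (j : ℕ) (m : Fin d → ℤ) :
    morreyTerm p φ (a + b) j m
      ≤ max 0 (2 * 2 ^ (1 / p) * (morreyTerm p φ a j m + morreyTerm p φ b j m)) := by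
  have hS : ∀ e : (Fin d → ℤ) → ℂ, 0 ≤ (∑ k ∈ cubeIndex j m, ‖e k‖ ^ p) ^ (1 / p) := fun e => by
    positivity
  have hD : (0 : ℝ) ≤ (((2 : ℝ) ^ j) ^ d) ^ (1 / p) := by positivity
  rcases le_total 0 (φ (2 ^ j)) with h | h
  · refine le_max_of_le_right ?_
    unfold morreyTerm
    refine le_trans (mul_le_mul_of_nonneg_left (morreySum_add_le hp a b (cubeIndex j m))
      (div_nonneg h hD)) (le_of_eq ?_)
    ring
  · exact le_max_of_le_left
      (mul_nonpos_of_nonpos_of_nonneg (div_nonpos_of_nonpos_of_nonneg h hD) (hS _))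

/-- The generalised Morrey sequence space `m_{φ,p} = m_{φ,p}(ℤ^d)`, as a linear subspace of the
space of all complex sequences indexed by `ℤ^d`. -/
def morreySpace {d : ℕ} {p : ℝ} (hp : 0 < p) (φ : ℝ → ℝ) :
    Submodule ℂ ((Fin d → ℤ) → ℂ) where
  carrier := {a | BddAbove (Set.range fun q : ℕ × (Fin d → ℤ) => morreyTerm p φ a q.1 q.2)}
  zero_mem' := by
    refine ⟨0, ?_⟩
    rintro _ ⟨q, rfl⟩
    have h := morreyTerm_smul hp φ 0 (0 : (Fin d → ℤ) → ℂ) q.1 q.2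
    simp only [smul_zero, norm_zero, zero_mul] at h
    exact h.le
  add_mem' := by
    rintro a b ⟨A, hA⟩ ⟨B, hB⟩
    refine ⟨max 0 (2 * 2 ^ (1 / p) * (A + B)), ?_⟩
    rintro _ ⟨q, rfl⟩
    refine (morreyTerm_add_le hp φ a b q.1 q.2).trans (max_le_max le_rfl ?_)
    have h1 := hA ⟨q, rfl⟩
    have h2 := hB ⟨q, rfl⟩
    simp only at h1 h2
    gcongr
  smul_mem' := by
    rintro c a ⟨A, hA⟩
    refine ⟨‖c‖ * A, ?_⟩
    rintro _ ⟨q, rfl⟩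
    have h1 := hA ⟨q, rfl⟩
    simp only at h1 ⊢
    rw [morreyTerm_smul hp]
    gcongr

/-- `m_{φ,p} = ℓ_p(ℤ^d)` in the sense of equivalent quasi-norms. -/
def MorreyEqLp {d : ℕ} {p : ℝ} (hp : 0 < p) (φ : ℝ → ℝ) : Prop :=
  (∀ a : (Fin d → ℤ) → ℂ, a ∈ morreySpace hp φ ↔ Memℓp a (ENNReal.ofReal p)) ∧
    ∃ c C : ℝ, 0 < c ∧ 0 < C ∧ ∀ a : (Fin d → ℤ) → ℂ, a ∈ morreySpace hp φ →
      c * (∑' k, ‖a k‖ ^ p) ^ (1 / p) ≤ morreyNorm p φ a ∧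
        morreyNorm p φ a ≤ C * (∑' k, ‖a k‖ ^ p) ^ (1 / p)

/-- Boundedness (equivalently, continuity) of a linear map `T : X → Y`, where `nX` and `nY` are the
quasi-norms of `X` and `Y`. -/
def IsBoundedOp {X Y : Type*} [AddCommGroup X] [Module ℂ X] [AddCommGroup Y] [Module ℂ Y]
    (nX : X → ℝ) (nY : Y → ℝ) (T : X →ₗ[ℂ] Y) : Prop :=
  ∃ C : ℝ, ∀ x : X, nY (T x) ≤ C * nX x

/-- Strict singularity of a linear map `T : X → Y` between quasi-Banach spaces: `T` is bounded, and
`inf {‖T x | Y‖ : x ∈ Z, ‖x | X‖ = 1} = 0` for each infinite-dimensional subspace `Z` of `X`. -/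
def IsStrictlySingular {X Y : Type*} [AddCommGroup X] [Module ℂ X] [AddCommGroup Y] [Module ℂ Y]
    (nX : X → ℝ) (nY : Y → ℝ) (T : X →ₗ[ℂ] Y) : Prop :=
  IsBoundedOp nX nY T ∧
    ∀ Z : Submodule ℂ X, ¬ FiniteDimensional ℂ Z →
      IsGLB {r : ℝ | ∃ x ∈ Z, nX x = 1 ∧ r = nY (T x)} 0

/-- `lim_{ν → ∞} 2^{-νd/p} φ(2^ν) = c`. -/
def ScaledLimit (d : ℕ) (p : ℝ) (φ : ℝ → ℝ) (c : ℝ) : Prop :=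
  Tendsto (fun ν : ℕ => (2 : ℝ) ^ (-((ν : ℝ) * (d : ℝ) / p)) * φ (2 ^ ν)) atTop (𝓝 c)

/-- The restriction of the quasi-norm to the space `m_{φ,p}`. -/
noncomputable def morreySpaceNorm {d : ℕ} {p : ℝ} (hp : 0 < p) (φ : ℝ → ℝ)
    (x : (morreySpace hp φ : Submodule ℂ ((Fin d → ℤ) → ℂ))) : ℝ :=
  morreyNorm p φ x.1

/-!
All properties of the embedding depend on the scaled weights `w_ν = 2^{-νd/p} φ(2^ν)`, which
decrease in `ν`, so that their limit exists and is either positive or zero. Always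
`‖·‖_∞ ≤ ‖· | m_{φ,p}‖ ≤ ‖· | ℓ_p‖`.

*Positive limit.* The lattice is the union of `2^d` dyadic orthants, each of them exhausted by an
increasing sequence of dyadic cubes, so weights bounded below give `m_{φ,p} = ℓ_p`
(`morreyEqLp_of_le_scaledWeight`).

*Zero limit.* A finitely supported sequence contributes at most `1` on every cube not contained in a
suitable finite set of lattice points (`exists_finset_morreyTerm_le_one`). This has two consequences.
First, points can be chosen so sparsely that `m_{φ,p}` contains the space `ℓ_∞(U)` of an infinite
set `U` of lattice points (`exists_infinite_morreyTerm_le`). Hence `m_{φ,p} ≠ ℓ_p`; and when this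
happens for `φ₁`, the embedding is bounded below on `ℓ_∞(U)`, so it is not strictly singular.
Second, when `m_{φ₁,p₁} = ℓ_{p₁}` and the limit for the target space is zero, a gliding hump in any
infinite-dimensional subspace of `ℓ_{p₁}` yields sequences with large `ℓ_{p₁}`-quasi-norm and bounded
quasi-norm in the target (`exists_tsum_ge_morreyTerm_le`), which is strict singularity. The hump is
built from partial sums and uses the triangle inequality only up to constants, so all exponents are
treated alike.

*Target `ℓ_{p₂}`.* The growth condition then forces `m_{φ₁,p₁} = ℓ_{p₁}` and `p₁ ≤ p₂`
(`le_and_exists_le_scaledWeight`). For `p₁ = p₂` the embedding is an isomorphism. For `p₁ < p₂` the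
gliding hump with respect to the supremum norm, which is the quasi-norm of `m_{1,p₁}`, together with
`‖x‖_{p₂}^{p₂} ≤ ‖x‖_∞^{p₂-p₁} ‖x‖_{p₁}^{p₁}`, gives strict singularity.

The embedding itself is monotonicity of power means over a cube for `p₂ ≤ p₁`, and the same
interpolation inequality for `p₁ ≤ p₂` (`morreyTerm_le_mul_morreyNorm`).
-/

/-! ### The scaled weights `2^{-νd/p} φ(2^ν)` -/

/-- The factor `φ(2^j) |Q_{-j,m}|^{-1/p}` in front of the `ℓ_p`-sum over the cube `Q_{-j,m}`; it
equals `2^{-jd/p} φ(2^j)`. -/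
noncomputable def scaledWeight (d : ℕ) (p : ℝ) (φ : ℝ → ℝ) (j : ℕ) : ℝ :=
  φ (2 ^ j) / (((2 : ℝ) ^ j) ^ d) ^ (1 / p)

theorem cubeVolume_rpow (d : ℕ) (p : ℝ) (j : ℕ) :
    (((2 : ℝ) ^ j) ^ d) ^ (1 / p) = (2 : ℝ) ^ ((j : ℝ) * (d / p)) := by
  rw [← pow_mul, ← Real.rpow_natCast, ← Real.rpow_mul (by norm_num)]
  congr 1
  push_cast
  ring

theorem scaledWeight_eq (d : ℕ) (p : ℝ) (φ : ℝ → ℝ) (j : ℕ) :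
    scaledWeight d p φ j = (2 : ℝ) ^ (-((j : ℝ) * (d : ℝ) / p)) * φ (2 ^ j) := by
  rw [scaledWeight, cubeVolume_rpow, Real.rpow_neg (by norm_num), mul_div_assoc, div_eq_inv_mul]

theorem scaledLimit_iff (d : ℕ) (p : ℝ) (φ : ℝ → ℝ) (c : ℝ) :
    ScaledLimit d p φ c ↔ Tendsto (scaledWeight d p φ) atTop (𝓝 c) := by
  rw [ScaledLimit, funext (scaledWeight_eq d p φ)]

section Weight

variable {d : ℕ} {p : ℝ} {φ : ℝ → ℝ}

theorem scaledWeight_pos (h : MemG d p φ) (j : ℕ) : 0 < scaledWeight d p φ j :=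
  div_pos (h.1 j) (by positivity)

theorem scaledWeight_antitone (h : MemG d p φ) : Antitone (scaledWeight d p φ) := by
  intro j k hjk
  have h1 := (h.2 j k hjk).2
  rw [div_le_iff₀ (h.1 j), sub_mul, Real.rpow_sub (by norm_num)] at h1
  rw [scaledWeight, scaledWeight, cubeVolume_rpow, cubeVolume_rpow,
    div_le_iff₀ (by positivity)]
  refine h1.trans (le_of_eq ?_)
  ring

theorem scaledWeight_zero (hone : φ 1 = 1) : scaledWeight d p φ 0 = 1 := by
  simp [scaledWeight, hone]

theorem scaledWeight_le_one (h : MemG d p φ) (hone : φ 1 = 1) (j : ℕ) :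
    scaledWeight d p φ j ≤ 1 :=
  (scaledWeight_antitone h (Nat.zero_le j)).trans (scaledWeight_zero hone).le

theorem scaledLimit_pos_or_zero (h : MemG d p φ) :
    (∃ c > 0, ScaledLimit d p φ c) ∨ ScaledLimit d p φ 0 := by
  have hb : BddBelow (Set.range (scaledWeight d p φ)) :=
    ⟨0, by rintro _ ⟨j, rfl⟩; exact (scaledWeight_pos h j).le⟩
  have ht := tendsto_atTop_ciInf (scaledWeight_antitone h) hb
  have hnn : 0 ≤ ⨅ j, scaledWeight d p φ j := le_ciInf fun j => (scaledWeight_pos h j).le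
  rcases hnn.eq_or_lt with h0 | h0
  · exact Or.inr ((scaledLimit_iff ..).2 (h0 ▸ ht))
  · exact Or.inl ⟨_, h0, (scaledLimit_iff ..).2 ht⟩

theorem exists_scaledLimit_pos_iff (h : MemG d p φ) :
    (∃ c > 0, ScaledLimit d p φ c) ↔ ∃ c > 0, ∀ j, c ≤ scaledWeight d p φ j := by
  constructor
  · rintro ⟨c, hc, hl⟩
    exact ⟨c, hc, (scaledWeight_antitone h).le_of_tendsto ((scaledLimit_iff ..).1 hl)⟩
  · rintro ⟨c, hc, hl⟩
    refine (scaledLimit_pos_or_zero h).resolve_right fun h0 => ?_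
    exact hc.not_ge (ge_of_tendsto' ((scaledLimit_iff ..).1 h0) hl)

end Weight

/-! ### Dyadic cubes of lattice points -/

section Cube

variable {d : ℕ}

theorem mem_cubeIndex {j : ℕ} {m k : Fin d → ℤ} :
    k ∈ cubeIndex j m ↔ ∀ i, k i / 2 ^ j = m i := by
  simp only [cubeIndex, Fintype.mem_piFinset, Finset.mem_Ico]
  refine forall_congr' fun i => ?_
  have h2 : (0 : ℤ) < 2 ^ j := by positivity
  rw [Int.ediv_eq_iff_of_pos h2, mul_comm (m i), mul_add, mul_one]

theorem cubeIndex_zero (m : Fin d → ℤ) : cubeIndex 0 m = {m} := by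
  ext k
  simp [mem_cubeIndex, funext_iff]

theorem card_cubeIndex (j : ℕ) (m : Fin d → ℤ) : (cubeIndex j m).card = (2 ^ j) ^ d := by
  have h : ∀ i, (2 ^ j * (m i + 1) - 2 ^ j * m i).toNat = 2 ^ j := fun i => by
    rw [mul_add, mul_one, add_sub_cancel_left]
    exact_mod_cast Int.toNat_natCast (2 ^ j)
  simp [cubeIndex, Fintype.card_piFinset, h]

/-- Every finite set of lattice points lies in the union of the `2^d` cubes of one generation that
have the origin as a corner. -/
theorem exists_subset_biUnion_cubeIndex (s : Finset (Fin d → ℤ)) :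
    ∃ j : ℕ, s ⊆ (Fintype.piFinset fun _ : Fin d => ({-1, 0} : Finset ℤ)).biUnion (cubeIndex j) := by
  obtain ⟨j, hj⟩ : ∃ j : ℕ, ∀ k ∈ s, ∀ i, |k i| < 2 ^ j := by
    refine ⟨∑ k ∈ s, ∑ i, (k i).natAbs, fun k hk i => ?_⟩
    have h1 : (k i).natAbs ≤ ∑ k ∈ s, ∑ i, (k i).natAbs :=
      (Finset.single_le_sum (f := fun i => (k i).natAbs) (fun _ _ => Nat.zero_le _)
        (Finset.mem_univ i)).trans
        (Finset.single_le_sum (f := fun k : Fin d → ℤ => ∑ i, (k i).natAbs)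
          (fun _ _ => Nat.zero_le _) hk)
    have h2 := h1.trans_lt Nat.lt_two_pow_self
    rw [Int.abs_eq_natAbs]
    exact_mod_cast h2
  refine ⟨j, fun k hk => Finset.mem_biUnion.2 ⟨fun i => k i / 2 ^ j, ?_, mem_cubeIndex.2 fun i => rfl⟩⟩
  refine Fintype.mem_piFinset.2 fun i => ?_
  have h2 : (0 : ℤ) < 2 ^ j := by positivity
  obtain ⟨h3, h4⟩ := abs_lt.1 (hj k hk i)
  rcases lt_or_ge (k i) 0 with h | h
  · have : k i / 2 ^ j = -1 := by
      rw [Int.ediv_eq_iff_of_pos h2]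
      constructor <;> linarith
    simp [this]
  · simp [Int.ediv_eq_zero_of_lt h h4]

end Cube

/-! ### The quasi-norm of `m_{φ,p}` -/

section Morrey

variable {d : ℕ} {p : ℝ} {φ : ℝ → ℝ}

theorem morreyTerm_eq (p : ℝ) (φ : ℝ → ℝ) (a : (Fin d → ℤ) → ℂ) (j : ℕ) (m : Fin d → ℤ) :
    morreyTerm p φ a j m
      = scaledWeight d p φ j * (∑ k ∈ cubeIndex j m, ‖a k‖ ^ p) ^ (1 / p) := rfl

theorem scaledWeight_nonneg (hφ : ∀ j : ℕ, 0 ≤ φ (2 ^ j)) (j : ℕ) : 0 ≤ scaledWeight d p φ j :=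
  div_nonneg (hφ j) (by positivity)

theorem morreyTerm_nonneg (hφ : ∀ j : ℕ, 0 ≤ φ (2 ^ j)) (a : (Fin d → ℤ) → ℂ) (j : ℕ)
    (m : Fin d → ℤ) : 0 ≤ morreyTerm p φ a j m :=
  mul_nonneg (scaledWeight_nonneg hφ j) (by positivity)

theorem morreyTerm_mono (hp : 0 < p) (hφ : ∀ j : ℕ, 0 ≤ φ (2 ^ j)) {a b : (Fin d → ℤ) → ℂ}
    {j : ℕ} {m : Fin d → ℤ} (h : ∀ k ∈ cubeIndex j m, ‖a k‖ ≤ ‖b k‖) :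
    morreyTerm p φ a j m ≤ morreyTerm p φ b j m := by
  refine mul_le_mul_of_nonneg_left (Real.rpow_le_rpow (by positivity) ?_ (by positivity))
    (scaledWeight_nonneg hφ j)
  exact Finset.sum_le_sum fun k hk => Real.rpow_le_rpow (norm_nonneg _) (h k hk) hp.le

theorem morreyTerm_eq_zero (hp : 0 < p) {a : (Fin d → ℤ) → ℂ} {j : ℕ} {m : Fin d → ℤ}
    (h : ∀ k ∈ cubeIndex j m, a k = 0) : morreyTerm p φ a j m = 0 := by
  rw [morreyTerm_eq, Finset.sum_eq_zero, Real.zero_rpow (by positivity), mul_zero]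
  intro k hk
  rw [h k hk, norm_zero, Real.zero_rpow hp.ne']

theorem morreyTerm_add_le_of_nonneg (hp : 0 < p) (hφ : ∀ j : ℕ, 0 ≤ φ (2 ^ j))
    (a b : (Fin d → ℤ) → ℂ) (j : ℕ) (m : Fin d → ℤ) :
    morreyTerm p φ (a + b) j m
      ≤ 2 * 2 ^ (1 / p) * (morreyTerm p φ a j m + morreyTerm p φ b j m) := by
  refine (morreyTerm_add_le hp φ a b j m).trans_eq (max_eq_right ?_)
  exact mul_nonneg (by positivity)
    (add_nonneg (morreyTerm_nonneg hφ a j m) (morreyTerm_nonneg hφ b j m))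

theorem morreyTerm_zero (hp : 0 < p) (hone : φ 1 = 1) (a : (Fin d → ℤ) → ℂ)
    (k : Fin d → ℤ) : morreyTerm p φ a 0 k = ‖a k‖ := by
  rw [morreyTerm_eq, scaledWeight_zero hone, cubeIndex_zero, Finset.sum_singleton, one_mul,
    ← Real.rpow_mul (norm_nonneg _), mul_one_div_cancel hp.ne', Real.rpow_one]

theorem mem_morreySpace_of_le (hp : 0 < p) {a : (Fin d → ℤ) → ℂ} {M : ℝ}
    (h : ∀ j m, morreyTerm p φ a j m ≤ M) : a ∈ morreySpace hp φ :=
  ⟨M, by rintro _ ⟨q, rfl⟩; exact h q.1 q.2⟩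

theorem morreyNorm_le {a : (Fin d → ℤ) → ℂ} {M : ℝ} (h : ∀ j m, morreyTerm p φ a j m ≤ M) :
    morreyNorm p φ a ≤ M :=
  ciSup_le fun q => h q.1 q.2

theorem morreyTerm_le_morreyNorm (hp : 0 < p) {a : (Fin d → ℤ) → ℂ} (ha : a ∈ morreySpace hp φ)
    (j : ℕ) (m : Fin d → ℤ) : morreyTerm p φ a j m ≤ morreyNorm p φ a :=
  le_ciSup (f := fun q : ℕ × (Fin d → ℤ) => morreyTerm p φ a q.1 q.2) ha (j, m)

theorem norm_le_morreyNorm (hp : 0 < p) (hone : φ 1 = 1) {a : (Fin d → ℤ) → ℂ}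
    (ha : a ∈ morreySpace hp φ) (k : Fin d → ℤ) : ‖a k‖ ≤ morreyNorm p φ a := by
  rw [← morreyTerm_zero hp hone a k]
  exact morreyTerm_le_morreyNorm hp ha 0 k

theorem morreyNorm_nonneg (hφ : ∀ j : ℕ, 0 ≤ φ (2 ^ j)) (a : (Fin d → ℤ) → ℂ) :
    0 ≤ morreyNorm p φ a :=
  Real.iSup_nonneg fun q => morreyTerm_nonneg hφ a q.1 q.2

theorem morreyNorm_smul (hp : 0 < p) (c : ℂ) (a : (Fin d → ℤ) → ℂ) :
    morreyNorm p φ (c • a) = ‖c‖ * morreyNorm p φ a := by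
  simp only [morreyNorm, morreyTerm_smul hp]
  exact (Real.mul_iSup_of_nonneg (norm_nonneg c) _).symm

/-- If the scaled weights tend to zero, a finitely supported sequence contributes at most `1` on
every cube outside a finite set of lattice points: large cubes carry a small weight, and only
finitely many small cubes meet the support. -/
theorem exists_finset_morreyTerm_le_one (hp : 0 < p) (hφ : ∀ j : ℕ, 0 ≤ φ (2 ^ j))
    (hlim : Tendsto (scaledWeight d p φ) atTop (𝓝 0)) {a : (Fin d → ℤ) → ℂ}
    {s : Finset (Fin d → ℤ)} (ha : ∀ k ∉ s, a k = 0) :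
    ∃ F : Finset (Fin d → ℤ), ∀ j m, ¬ cubeIndex j m ⊆ F → morreyTerm p φ a j m ≤ 1 := by
  classical
  set S := (∑ k ∈ s, ‖a k‖ ^ p) ^ (1 / p) with hS
  have hlim' : Tendsto (fun j => scaledWeight d p φ j * S) atTop (𝓝 0) := by
    simpa using hlim.mul_const S
  obtain ⟨J, hJ⟩ := eventually_atTop.1 (hlim'.eventually (eventually_le_nhds (zero_lt_one' ℝ)))
  refine ⟨(Finset.range J).biUnion fun j => s.biUnion fun k => cubeIndex j fun i => k i / 2 ^ j,
    fun j m hF => ?_⟩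
  by_cases hj : J ≤ j
  · refine le_trans ?_ (hJ j hj)
    refine mul_le_mul_of_nonneg_left (Real.rpow_le_rpow (by positivity) ?_ (by positivity))
      (scaledWeight_nonneg hφ j)
    rw [← Finset.sum_filter_add_sum_filter_not (cubeIndex j m) (· ∈ s),
      Finset.sum_eq_zero (s := Finset.filter (fun k => k ∉ s) _), add_zero]
    · refine Finset.sum_le_sum_of_subset_of_nonneg (fun k hk => (Finset.mem_filter.1 hk).2)
        fun _ _ _ => by positivity
    · intro k hk
      rw [ha k (Finset.mem_filter.1 hk).2, norm_zero, Real.zero_rpow hp.ne']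
  · rw [morreyTerm_eq_zero hp]
    · exact zero_le_one
    · intro k hk
      by_contra hne
      have hks : k ∈ s := by
        by_contra h
        exact hne (ha k h)
      refine hF fun l hl => ?_
      simp only [Finset.mem_biUnion, Finset.mem_range]
      exact ⟨j, not_le.1 hj, k, hks, by rwa [funext (mem_cubeIndex.1 hk)]⟩

/-- If the scaled weights tend to zero, the sequences supported on a suitable infinite set `U` of
lattice points belong to `m_{φ,p}` as soon as they are bounded: `m_{φ,p}` contains `ℓ_∞(U)`. -/
theorem exists_infinite_morreyTerm_le (hp : 0 < p) (hφ : MemG d p φ) (hone : φ 1 = 1) (hd : 1 ≤ d)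
    (hlim : Tendsto (scaledWeight d p φ) atTop (𝓝 0)) :
    ∃ (U : Set (Fin d → ℤ)) (K : ℝ), U.Infinite ∧ 0 < K ∧ ∀ (a : (Fin d → ℤ) → ℂ) (M : ℝ),
      (∀ k ∉ U, a k = 0) → (∀ k, ‖a k‖ ≤ M) → ∀ j m, morreyTerm p φ a j m ≤ M * K := by
  classical
  have hnn : ∀ j : ℕ, 0 ≤ φ (2 ^ j) := fun j => (hφ.1 j).le
  set K : ℝ := 2 * 2 ^ (1 / p) * (1 + 1) with hK
  have hKpos : 0 < K := by positivity
  let χ : Finset (Fin d → ℤ) → (Fin d → ℤ) → ℂ := fun s k => if k ∈ s then 1 else 0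
  -- A maximal set among those all of whose finite parts have quasi-norm at most `K`.
  let S : Set (Set (Fin d → ℤ)) :=
    {A | ∀ s : Finset (Fin d → ℤ), ↑s ⊆ A → ∀ j m, morreyTerm p φ (χ s) j m ≤ K}
  obtain ⟨U, -, hU⟩ := zorn_subset_nonempty S
    (fun c hc hchain hne => by
      refine ⟨⋃₀ c, fun s hs => ?_, fun t ht => Set.subset_sUnion_of_mem ht⟩
      obtain ⟨t, htc, hst⟩ := hchain.directedOn.exists_mem_subset_of_finite_of_subset_sUnion hne
        s.finite_toSet hs
      exact hc htc s hst)
    ∅ (fun s hs j m => by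
      rw [morreyTerm_eq_zero hp]
      · exact hKpos.le
      · intro k _
        have : s = ∅ := by simpa using hs
        simp [χ, this])
  have hUS : ∀ s : Finset (Fin d → ℤ), ↑s ⊆ U → ∀ j m, morreyTerm p φ (χ s) j m ≤ K := hU.prop
  refine ⟨U, K, fun hfin => ?_, hKpos, fun a M ha hM j m => ?_⟩
  · -- A finite set in `S` can be enlarged by any point outside a suitable finite set.
    obtain ⟨F, hF⟩ := exists_finset_morreyTerm_le_one hp hnn hlim (a := χ hfin.toFinset)
      (s := hfin.toFinset) (fun k hk => if_neg hk)
    have : Nonempty (Fin d) := ⟨⟨0, hd⟩⟩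
    obtain ⟨x, hx⟩ := Infinite.exists_notMem_finset (F ∪ hfin.toFinset)
    rw [Finset.mem_union, not_or] at hx
    have hmem : insert x U ∈ S := by
      intro s hs j m
      by_cases hxQ : x ∈ cubeIndex j m
      · have h1 : morreyTerm p φ (χ hfin.toFinset) j m ≤ 1 := hF j m fun h => hx.1 (h hxQ)
        have h2 : morreyTerm p φ (χ {x}) j m ≤ 1 := by
          have : ∑ k ∈ cubeIndex j m, ‖χ {x} k‖ ^ p = 1 := by
            rw [Finset.sum_eq_single_of_mem x hxQ]
            · simp [χ]
            · intro k _ hk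
              simp [χ, hk, hp.ne']
          rw [morreyTerm_eq, this, Real.one_rpow, mul_one]
          exact scaledWeight_le_one hφ hone j
        calc morreyTerm p φ (χ s) j m
            ≤ morreyTerm p φ (χ hfin.toFinset + χ {x}) j m := by
              refine morreyTerm_mono hp hnn fun k _ => ?_
              by_cases hk : k ∈ s
              · rcases hs hk with rfl | hkU
                · have : k ∉ hfin.toFinset := hx.2
                  simp only [χ, hk, Pi.add_apply, this]
                  simp
                · have hkx : k ≠ x := by
                    rintro rfl
                    exact hx.2 (hfin.mem_toFinset.2 hkU)
                  simp [χ, hkU, hkx, hk]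
              · simp [χ, hk]
          _ ≤ 2 * 2 ^ (1 / p) * (morreyTerm p φ (χ hfin.toFinset) j m
                + morreyTerm p φ (χ {x}) j m) := morreyTerm_add_le_of_nonneg hp hnn _ _ j m
          _ ≤ K := by rw [hK]; gcongr
      · refine (morreyTerm_mono hp hnn fun k hk => ?_).trans (hUS (s.erase x) ?_ j m)
        · have hkx : k ≠ x := by
            rintro rfl
            exact hxQ hk
          simp [χ, hkx]
        · intro k hk
          rw [Finset.mem_coe, Finset.mem_erase] at hk
          exact (hs hk.2).resolve_left hk.1
    have hsub : insert x U ⊆ U := hU.le_of_ge hmem (Set.subset_insert x U)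
    exact hx.2 (hfin.mem_toFinset.2 (hsub (Set.mem_insert x U)))
  · have hM0 : 0 ≤ M := (norm_nonneg _).trans (hM 0)
    calc morreyTerm p φ a j m
        ≤ morreyTerm p φ ((M : ℂ) • χ ((cubeIndex j m).filter (· ∈ U))) j m := by
          refine morreyTerm_mono hp hnn fun k hk => ?_
          by_cases hkU : k ∈ U
          · simpa [χ, hk, hkU, abs_of_nonneg hM0] using hM k
          · rw [ha k hkU, norm_zero]
            exact norm_nonneg _
      _ = M * morreyTerm p φ (χ ((cubeIndex j m).filter (· ∈ U))) j m := by
          rw [morreyTerm_smul hp, Complex.norm_real, Real.norm_of_nonneg hM0]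
      _ ≤ M * K := by
          refine mul_le_mul_of_nonneg_left (hUS _ (fun k hk => ?_) j m) hM0
          exact (Finset.mem_filter.1 hk).2

end Morrey

/-! ### Comparison with `ℓ_p` -/

section Lp

variable {d : ℕ} {p : ℝ} {φ : ℝ → ℝ}

theorem memLp_ofReal_iff (hp : 0 < p) (a : (Fin d → ℤ) → ℂ) :
    Memℓp a (ENNReal.ofReal p) ↔ Summable fun k => ‖a k‖ ^ p := by
  have h : (ENNReal.ofReal p).toReal = p := ENNReal.toReal_ofReal hp.le
  rw [memℓp_gen_iff (by rwa [h]), h]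

theorem morreyTerm_le_tsum (hp : 0 < p) (hφ : MemG d p φ) (hone : φ 1 = 1)
    {a : (Fin d → ℤ) → ℂ} (ha : Summable fun k => ‖a k‖ ^ p) (j : ℕ) (m : Fin d → ℤ) :
    morreyTerm p φ a j m ≤ (∑' k, ‖a k‖ ^ p) ^ (1 / p) := by
  rw [morreyTerm_eq]
  refine (mul_le_of_le_one_left (by positivity) (scaledWeight_le_one hφ hone j)).trans ?_
  exact Real.rpow_le_rpow (by positivity) (ha.sum_le_tsum _ fun _ _ => by positivity)
    (by positivity)

/-- If the scaled weights stay above `c`, the quasi-norm controls the `ℓ_p`-sum over each of the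
`2^d` dyadic orthants. -/
theorem sum_le_of_le_scaledWeight (hp : 0 < p) {c : ℝ} (hc : 0 < c)
    (hw : ∀ j, c ≤ scaledWeight d p φ j) {a : (Fin d → ℤ) → ℂ} (ha : a ∈ morreySpace hp φ)
    (s : Finset (Fin d → ℤ)) :
    ∑ k ∈ s, ‖a k‖ ^ p ≤ 2 ^ d * (morreyNorm p φ a / c) ^ p := by
  classical
  obtain ⟨j, hj⟩ := exists_subset_biUnion_cubeIndex s
  have hQ : ∀ m, ∑ k ∈ cubeIndex j m, ‖a k‖ ^ p ≤ (morreyNorm p φ a / c) ^ p := by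
    intro m
    have h0 : 0 ≤ ∑ k ∈ cubeIndex j m, ‖a k‖ ^ p := by positivity
    have h1 : c * (∑ k ∈ cubeIndex j m, ‖a k‖ ^ p) ^ (1 / p) ≤ morreyNorm p φ a :=
      (mul_le_mul_of_nonneg_right (hw j) (by positivity)).trans (morreyTerm_le_morreyNorm hp ha j m)
    rw [← le_div_iff₀' hc] at h1
    have h2 := Real.rpow_le_rpow (by positivity) h1 hp.le
    rwa [← Real.rpow_mul h0, one_div_mul_cancel hp.ne', Real.rpow_one] at h2
  calc ∑ k ∈ s, ‖a k‖ ^ p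
      ≤ ∑ k ∈ (Fintype.piFinset fun _ : Fin d => ({-1, 0} : Finset ℤ)).biUnion (cubeIndex j),
          ‖a k‖ ^ p := Finset.sum_le_sum_of_subset_of_nonneg hj fun _ _ _ => by positivity
    _ = ∑ m ∈ Fintype.piFinset fun _ : Fin d => ({-1, 0} : Finset ℤ),
          ∑ k ∈ cubeIndex j m, ‖a k‖ ^ p := by
        refine Finset.sum_biUnion fun m _ m' _ hne => Finset.disjoint_left.2 fun k hk hk' => hne ?_
        rw [← funext (mem_cubeIndex.1 hk), ← funext (mem_cubeIndex.1 hk')]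
    _ ≤ ∑ m ∈ Fintype.piFinset fun _ : Fin d => ({-1, 0} : Finset ℤ),
          (morreyNorm p φ a / c) ^ p := Finset.sum_le_sum fun m _ => hQ m
    _ = 2 ^ d * (morreyNorm p φ a / c) ^ p := by
        simp [Fintype.card_piFinset]

theorem morreyEqLp_of_le_scaledWeight (hp : 0 < p) (hφ : MemG d p φ) (hone : φ 1 = 1) {c : ℝ}
    (hc : 0 < c) (hw : ∀ j, c ≤ scaledWeight d p φ j) : MorreyEqLp (d := d) hp φ := by
  have hsum : ∀ a ∈ morreySpace (d := d) hp φ, Summable fun k => ‖a k‖ ^ p := fun a ha =>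
    summable_of_sum_le (fun _ => by positivity) (sum_le_of_le_scaledWeight hp hc hw ha)
  refine ⟨fun a => ?_, c / (2 ^ d) ^ (1 / p), 1, by positivity, one_pos, fun a ha => ⟨?_, ?_⟩⟩
  · rw [memLp_ofReal_iff hp]
    exact ⟨hsum a, fun h => mem_morreySpace_of_le hp (morreyTerm_le_tsum hp hφ hone h)⟩
  · have hN : 0 ≤ morreyNorm p φ a := morreyNorm_nonneg (fun j => (hφ.1 j).le) a
    have h1 : ∑' k, ‖a k‖ ^ p ≤ 2 ^ d * (morreyNorm p φ a / c) ^ p :=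
      (hsum a ha).tsum_le_of_sum_le (sum_le_of_le_scaledWeight hp hc hw ha)
    have h2 := Real.rpow_le_rpow (tsum_nonneg fun _ => by positivity) h1
      (one_div_pos.2 hp).le
    rw [Real.mul_rpow (by positivity) (by positivity), ← Real.rpow_mul (by positivity),
      mul_one_div_cancel hp.ne', Real.rpow_one, mul_div_assoc', le_div_iff₀ hc] at h2
    rw [div_mul_eq_mul_div, div_le_iff₀ (by positivity)]
    linarith
  · rw [one_mul]
    exact morreyNorm_le (morreyTerm_le_tsum hp hφ hone (hsum a ha))

theorem morreyEqLp_iff (hp : 0 < p) (hφ : MemG d p φ) (hone : φ 1 = 1) (hd : 1 ≤ d) :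
    (∃ c > 0, ScaledLimit d p φ c) ↔ MorreyEqLp (d := d) hp φ := by
  classical
  constructor
  · rw [exists_scaledLimit_pos_iff hφ]
    rintro ⟨c, hc, hw⟩
    exact morreyEqLp_of_le_scaledWeight hp hφ hone hc hw
  · intro h
    refine (scaledLimit_pos_or_zero hφ).resolve_right fun h0 => ?_
    -- The characteristic function of the infinite set `U` lies in `m_{φ,p}` but not in `ℓ_p`.
    obtain ⟨U, K, hU, -, hK⟩ :=
      exists_infinite_morreyTerm_le hp hφ hone hd ((scaledLimit_iff ..).1 h0)
    let χ : (Fin d → ℤ) → ℂ := U.indicator 1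
    have hmem : χ ∈ morreySpace hp φ := mem_morreySpace_of_le hp
      (hK χ 1 (fun k hk => Set.indicator_of_notMem hk _) fun k => by
        by_cases hk : k ∈ U <;> simp [χ, hk])
    have hs := (memLp_ofReal_iff hp χ).1 ((h.1 χ).1 hmem)
    have hfin : {k | (1 : ℝ) ≤ ‖χ k‖ ^ p}.Finite := by
      have := hs.tendsto_cofinite_zero.eventually (eventually_lt_nhds (zero_lt_one' ℝ))
      simpa [Filter.eventually_cofinite] using this
    exact hU (hfin.subset fun k hk => by simp [χ, hk])

end Lp

/-! ### The continuous embedding -/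

section Embedding

variable {d : ℕ} {p₁ p₂ : ℝ} {φ₁ φ₂ : ℝ → ℝ}

theorem morreyTerm_eq_mean (p : ℝ) (φ : ℝ → ℝ) (a : (Fin d → ℤ) → ℂ) (j : ℕ)
    (m : Fin d → ℤ) : morreyTerm p φ a j m
      = φ (2 ^ j) * ((((2 : ℝ) ^ j) ^ d)⁻¹ * ∑ k ∈ cubeIndex j m, ‖a k‖ ^ p) ^ (1 / p) := by
  rw [Real.mul_rpow (by positivity) (by positivity), Real.inv_rpow (by positivity), morreyTerm,
    div_eq_mul_inv, mul_assoc]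

/-- Power means over a cube increase with the exponent. -/
theorem cubeMean_le_cubeMean (hp₂ : 0 < p₂) (hle : p₂ ≤ p₁) (a : (Fin d → ℤ) → ℂ) (j : ℕ)
    (m : Fin d → ℤ) :
    ((((2 : ℝ) ^ j) ^ d)⁻¹ * ∑ k ∈ cubeIndex j m, ‖a k‖ ^ p₂) ^ (1 / p₂)
      ≤ ((((2 : ℝ) ^ j) ^ d)⁻¹ * ∑ k ∈ cubeIndex j m, ‖a k‖ ^ p₁) ^ (1 / p₁) := by
  have hp₁ : 0 < p₁ := hp₂.trans_le hle
  have h := Real.rpow_arith_mean_le_arith_mean_rpow (cubeIndex j m)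
    (fun _ => (((2 : ℝ) ^ j) ^ d)⁻¹) (fun k => ‖a k‖ ^ p₂) (fun _ _ => by positivity)
    (by rw [Finset.sum_const, card_cubeIndex, nsmul_eq_mul]
        push_cast
        exact mul_inv_cancel₀ (by positivity))
    (fun _ _ => by positivity) (p := p₁ / p₂) ((one_le_div hp₂).2 hle)
  have e : ∀ k, (‖a k‖ ^ p₂) ^ (p₁ / p₂) = ‖a k‖ ^ p₁ := fun k => by
    rw [← Real.rpow_mul (norm_nonneg _), mul_div_cancel₀ _ hp₂.ne']
  simp only [e, ← Finset.mul_sum] at h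
  have h' := Real.rpow_le_rpow (by positivity) h (one_div_pos.2 hp₁).le
  rw [← Real.rpow_mul (by positivity)] at h'
  convert h' using 2
  field_simp

/-- Summed over the lattice, this puts bounded sequences of `ℓ_{p₁}` into `ℓ_{p₂}` for
`p₁ ≤ p₂`. -/
theorem norm_rpow_le_of_norm_le {a : ℂ} {B : ℝ} (hp₁ : 0 < p₁) (hle : p₁ ≤ p₂) (h : ‖a‖ ≤ B) :
    ‖a‖ ^ p₂ ≤ B ^ (p₂ - p₁) * ‖a‖ ^ p₁ := by
  calc ‖a‖ ^ p₂ = ‖a‖ ^ (p₂ - p₁) * ‖a‖ ^ p₁ := by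
        rw [← Real.rpow_add_of_nonneg (norm_nonneg _) (sub_nonneg.2 hle) hp₁.le, sub_add_cancel]
    _ ≤ B ^ (p₂ - p₁) * ‖a‖ ^ p₁ := by
        gcongr

/-- The embedding estimate: monotonicity of power means for `p₂ ≤ p₁`, interpolation with the
supremum norm for `p₁ ≤ p₂`. -/
theorem morreyTerm_le_mul_morreyNorm (hp₁ : 0 < p₁) (hp₂ : 0 < p₂) (hφ₁ : MemG d p₁ φ₁)
    (hφ₂ : MemG d p₂ φ₂) (hone₁ : φ₁ 1 = 1) {C : ℝ}
    (hC : ∀ j : ℕ, φ₂ (2 ^ j) ≤ C * φ₁ (2 ^ j) ^ min 1 (p₁ / p₂)) {a : (Fin d → ℤ) → ℂ}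
    (ha : a ∈ morreySpace hp₁ φ₁) (j : ℕ) (m : Fin d → ℤ) :
    morreyTerm p₂ φ₂ a j m ≤ C * morreyNorm p₁ φ₁ a := by
  have hC0 : 0 < C := by
    have h := (hφ₂.1 j).trans_le (hC j)
    exact pos_of_mul_pos_left h (Real.rpow_nonneg (hφ₁.1 j).le _)
  have hN := morreyTerm_le_morreyNorm hp₁ ha j m
  set N := morreyNorm p₁ φ₁ a with hNdef
  have hN0 : 0 ≤ N := morreyNorm_nonneg (fun j => (hφ₁.1 j).le) a
  have hj := hC j
  rcases le_total p₂ p₁ with hle | hle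
  · rw [min_eq_left ((one_le_div hp₂).2 hle), Real.rpow_one] at hj
    rw [morreyTerm_eq_mean] at hN ⊢
    calc φ₂ (2 ^ j) * ((((2 : ℝ) ^ j) ^ d)⁻¹ * ∑ k ∈ cubeIndex j m, ‖a k‖ ^ p₂) ^ (1 / p₂)
        ≤ (C * φ₁ (2 ^ j))
            * ((((2 : ℝ) ^ j) ^ d)⁻¹ * ∑ k ∈ cubeIndex j m, ‖a k‖ ^ p₁) ^ (1 / p₁) :=
          mul_le_mul hj (cubeMean_le_cubeMean hp₂ hle a j m) (by positivity)
            (mul_nonneg hC0.le (hφ₁.1 j).le)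
      _ ≤ C * N := by
          rw [mul_assoc]
          exact mul_le_mul_of_nonneg_left hN hC0.le
  · rw [min_eq_right ((div_le_one hp₂).2 hle)] at hj
    rw [morreyTerm_eq_mean] at hN ⊢
    set V : ℝ := (((2 : ℝ) ^ j) ^ d)⁻¹ with hV
    set S := ∑ k ∈ cubeIndex j m, ‖a k‖ ^ p₁ with hS
    have hV0 : 0 ≤ V := by positivity
    have hS0 : 0 ≤ S := by positivity
    have hφ0 := (hφ₁.1 j).le
    have h1 : ∑ k ∈ cubeIndex j m, ‖a k‖ ^ p₂ ≤ N ^ (p₂ - p₁) * S := by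
      rw [hS, Finset.mul_sum]
      exact Finset.sum_le_sum fun k _ =>
        norm_rpow_le_of_norm_le hp₁ hle (norm_le_morreyNorm hp₁ hone₁ ha k)
    have h2 : (V * ∑ k ∈ cubeIndex j m, ‖a k‖ ^ p₂) ^ (1 / p₂)
        ≤ N ^ (1 - p₁ / p₂) * ((V * S) ^ (1 / p₁)) ^ (p₁ / p₂) := by
      calc (V * ∑ k ∈ cubeIndex j m, ‖a k‖ ^ p₂) ^ (1 / p₂)
          ≤ (N ^ (p₂ - p₁) * (V * S)) ^ (1 / p₂) := by
            refine Real.rpow_le_rpow (by positivity) ?_ (by positivity)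
            calc V * ∑ k ∈ cubeIndex j m, ‖a k‖ ^ p₂ ≤ V * (N ^ (p₂ - p₁) * S) := by gcongr
              _ = N ^ (p₂ - p₁) * (V * S) := by ring
        _ = N ^ (1 - p₁ / p₂) * ((V * S) ^ (1 / p₁)) ^ (p₁ / p₂) := by
            rw [Real.mul_rpow (by positivity) (by positivity), ← Real.rpow_mul hN0,
              ← Real.rpow_mul (by positivity)]
            congr 2 <;> field_simp
    have h3 : φ₁ (2 ^ j) ^ (p₁ / p₂) * ((V * S) ^ (1 / p₁)) ^ (p₁ / p₂) ≤ N ^ (p₁ / p₂) := by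
      rw [← Real.mul_rpow hφ0 (by positivity)]
      exact Real.rpow_le_rpow (by positivity) hN (by positivity)
    have hr : 0 ≤ 1 - p₁ / p₂ := sub_nonneg.2 ((div_le_one hp₂).2 hle)
    calc φ₂ (2 ^ j) * (V * ∑ k ∈ cubeIndex j m, ‖a k‖ ^ p₂) ^ (1 / p₂)
        ≤ (C * φ₁ (2 ^ j) ^ (p₁ / p₂))
            * (N ^ (1 - p₁ / p₂) * ((V * S) ^ (1 / p₁)) ^ (p₁ / p₂)) :=
          mul_le_mul hj h2 (by positivity) (by positivity)
      _ = C * (N ^ (1 - p₁ / p₂)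
            * (φ₁ (2 ^ j) ^ (p₁ / p₂) * ((V * S) ^ (1 / p₁)) ^ (p₁ / p₂))) := by ring
      _ ≤ C * (N ^ (1 - p₁ / p₂) * N ^ (p₁ / p₂)) := by gcongr
      _ = C * N := by
          rw [← Real.rpow_add_of_nonneg hN0 hr (by positivity), sub_add_cancel, Real.rpow_one]

end Embedding

/-! ### The gliding hump -/

section GlidingHump

variable {d : ℕ} {p q : ℝ} {φ : ℝ → ℝ}

theorem exists_mem_ne_zero_of_forall_finset {Z : Submodule ℂ ((Fin d → ℤ) → ℂ)}
    (hZ : ¬ FiniteDimensional ℂ Z) (F : Finset (Fin d → ℤ)) :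
    ∃ x ∈ Z, x ≠ 0 ∧ ∀ k ∈ F, x k = 0 := by
  by_contra! h
  refine hZ (Module.Finite.of_injective
    ((LinearMap.funLeft ℂ ℂ (Subtype.val : F → (Fin d → ℤ))).comp Z.subtype) ?_)
  rw [← LinearMap.ker_eq_bot, LinearMap.ker_eq_bot']
  rintro ⟨x, hx⟩ hx0
  by_contra hne
  obtain ⟨k, hk, hxk⟩ := h x hx fun h0 => hne (Subtype.ext h0)
  exact hxk (congrFun hx0 ⟨k, hk⟩)

theorem exists_mem_tsum_eq (hp : 0 < p) {Z : Submodule ℂ ((Fin d → ℤ) → ℂ)}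
    (hZ : ¬ FiniteDimensional ℂ Z) (hsum : ∀ x ∈ Z, Summable fun k => ‖x k‖ ^ p)
    (F : Finset (Fin d → ℤ)) {L : ℝ} (hL : 0 ≤ L) :
    ∃ x ∈ Z, ∑' k, ‖x k‖ ^ p = L ∧ ∀ k ∈ F, x k = 0 := by
  obtain ⟨x, hxZ, hx0, hxF⟩ := exists_mem_ne_zero_of_forall_finset hZ F
  obtain ⟨k, hk⟩ := Function.ne_iff.1 hx0
  have hpos : 0 < ∑' k, ‖x k‖ ^ p :=
    (hsum x hxZ).tsum_pos (fun _ => by positivity) k (Real.rpow_pos_of_pos (norm_pos_iff.2 hk) p)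
  set S := ∑' k, ‖x k‖ ^ p with hS
  refine ⟨(((L / S) ^ (1 / p) : ℝ) : ℂ) • x, Z.smul_mem _ hxZ, ?_, fun k hk => by simp [hxF k hk]⟩
  have hLS : 0 ≤ L / S := by positivity
  have e : ∀ k, ‖((((L / S) ^ (1 / p) : ℝ) : ℂ) • x) k‖ ^ p = (L / S) * ‖x k‖ ^ p := fun k => by
    rw [Pi.smul_apply, norm_smul, Complex.norm_real, Real.norm_of_nonneg (by positivity),
      Real.mul_rpow (by positivity) (norm_nonneg _), ← Real.rpow_mul hLS,
      one_div_mul_cancel hp.ne', Real.rpow_one]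
  simp only [e]
  rw [tsum_mul_left, ← hS, div_mul_cancel₀ _ hpos.ne']

/-- Gliding hump: if the scaled weights tend to zero, an infinite-dimensional subspace of `ℓ_p`
contains sequences with arbitrarily large `ℓ_p`-quasi-norm and uniformly bounded
`m_{φ,q}`-quasi-norm. One adds to the sequence `y` found so far a fixed multiple of a normalised
`x` vanishing wherever `y` is not yet small; on a cube that meets the support of `x`, the
essential part of `y` then contributes at most `1`. -/
theorem exists_tsum_ge_morreyTerm_le (hp : 0 < p) (hq : 0 < q) (hφ : ∀ j : ℕ, 0 ≤ φ (2 ^ j))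
    (hlim : Tendsto (scaledWeight d q φ) atTop (𝓝 0)) {C : ℝ} (hC0 : 0 ≤ C)
    (hC : ∀ a : (Fin d → ℤ) → ℂ, (Summable fun k => ‖a k‖ ^ p) →
      ∀ j m, morreyTerm q φ a j m ≤ C * (∑' k, ‖a k‖ ^ p) ^ (1 / p))
    {Z : Submodule ℂ ((Fin d → ℤ) → ℂ)} (hZ : ¬ FiniteDimensional ℂ Z)
    (hsum : ∀ x ∈ Z, Summable fun k => ‖x k‖ ^ p) :
    ∃ K : ℝ, ∀ N : ℝ, ∃ y ∈ Z, N ≤ ∑' k, ‖y k‖ ^ p ∧ ∀ j m, morreyTerm q φ y j m ≤ K := by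
  classical
  set A : ℝ := 2 * 2 ^ (1 / q) with hA
  -- With `∑ |x|^p = 3 * 2^p`, adding `x` to `y` increases the `ℓ_p`-sum by at least `3 - 2`, where
  -- `2` is the price for the tail of `y`.
  set L : ℝ := 3 * 2 ^ p with hL
  have hL0 : 0 ≤ L := by positivity
  set K : ℝ := A * (1 + A * (C + C * L ^ (1 / p))) with hK
  have hA0 : 0 ≤ A := by positivity
  have hK0 : 0 ≤ K := by positivity
  suffices h : ∀ n : ℕ, ∃ y ∈ Z, (n : ℝ) ≤ ∑' k, ‖y k‖ ^ p ∧ ∀ j m, morreyTerm q φ y j m ≤ K by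
    refine ⟨K, fun N => ?_⟩
    obtain ⟨n, hn⟩ := exists_nat_ge N
    obtain ⟨y, hy, hny, hyK⟩ := h n
    exact ⟨y, hy, hn.trans hny, hyK⟩
  intro n
  induction n with
  | zero =>
    refine ⟨0, Z.zero_mem, ?_, fun j m => ?_⟩
    · rw [Nat.cast_zero]
      exact tsum_nonneg fun _ => by positivity
    · rw [morreyTerm_eq_zero (a := 0) hq fun _ _ => rfl]
      exact hK0
  | succ n ih =>
    obtain ⟨y, hyZ, hny, hyK⟩ := ih
    have hys := hsum y hyZ
    -- The tail of `y` outside `D` is small, the rest is finitely supported.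
    obtain ⟨D, hD⟩ := ((tendsto_tsum_compl_atTop_zero fun k => ‖y k‖ ^ p).eventually
      (eventually_le_nhds (zero_lt_one' ℝ))).exists
    let yi : (Fin d → ℤ) → ℂ := fun k => if k ∈ D then y k else 0
    let yo : (Fin d → ℤ) → ℂ := fun k => if k ∈ D then 0 else y k
    have hyio : y = yi + yo := by
      funext k
      by_cases hk : k ∈ D <;> simp [yi, yo, hk]
    have hyo_le : ∀ k, ‖yo k‖ ^ p ≤ ‖y k‖ ^ p := fun k => by
      by_cases hk : k ∈ D
      · simp only [yo, hk, if_true, norm_zero, Real.zero_rpow hp.ne']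
        positivity
      · simp [yo, hk]
    have hyos : Summable fun k => ‖yo k‖ ^ p :=
      hys.of_nonneg_of_le (fun _ => by positivity) hyo_le
    have hyo1 : ∑' k, ‖yo k‖ ^ p ≤ 1 := by
      refine le_of_eq_of_le ?_ hD
      rw [← tsum_subtype_eq_of_support_subset (s := {k | k ∉ D})]
      · exact tsum_congr fun k => by simp only [yo, if_neg (show (k : Fin d → ℤ) ∉ D from k.2)]
      · intro k hk hkD
        exact hk (by simp [yo, hkD, hp.ne'])
    obtain ⟨F, hF⟩ := exists_finset_morreyTerm_le_one hq hφ hlim (a := yi) (s := D)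
      fun k hk => if_neg hk
    obtain ⟨x, hxZ, hxL, hx0⟩ := exists_mem_tsum_eq hp hZ hsum (D ∪ F) hL0
    have hxs := hsum x hxZ
    refine ⟨y + x, Z.add_mem hyZ hxZ, ?_, fun j m => ?_⟩
    · have hyxs := hsum _ (Z.add_mem hyZ hxZ)
      have hpt : ∀ k, ‖y k‖ ^ p + (2 ^ p)⁻¹ * ‖x k‖ ^ p ≤ ‖(y + x) k‖ ^ p + 2 * ‖yo k‖ ^ p := by
        intro k
        by_cases hk : k ∈ D
        · simp [yo, hk, hx0 k (Finset.mem_union_left _ hk), hp.ne']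
        · have h1 : ‖x k‖ ^ p ≤ 2 ^ p * (‖(y + x) k‖ ^ p + ‖y k‖ ^ p) := by
            refine (Real.rpow_le_rpow (norm_nonneg _) ?_ hp.le).trans
              (add_rpow_le_two_rpow hp.le (norm_nonneg _) (norm_nonneg _))
            simpa using norm_sub_le ((y + x) k) (y k)
          rw [← inv_mul_le_iff₀ (by positivity)] at h1
          simp only [yo, hk, if_false]
          linarith
      have h2 := Summable.tsum_le_tsum hpt (hys.add (hxs.mul_left _)) (hyxs.add (hyos.mul_left _))
      rw [hys.tsum_add (hxs.mul_left _), hyxs.tsum_add (hyos.mul_left _), tsum_mul_left,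
        tsum_mul_left, hxL, hL] at h2
      have h3 : ((2 : ℝ) ^ p)⁻¹ * (3 * 2 ^ p) = 3 := by
        field_simp
      push_cast
      linarith
    · by_cases hQ : cubeIndex j m ⊆ F
      · refine (morreyTerm_mono hq hφ fun k hk => ?_).trans (hyK j m)
        simp [hx0 k (Finset.mem_union_right _ (hQ hk))]
      · have h1 : morreyTerm q φ yo j m ≤ C := by
          refine (hC yo hyos j m).trans (mul_le_of_le_one_right hC0 ?_)
          exact Real.rpow_le_one (tsum_nonneg fun _ => by positivity) hyo1 (by positivity)
        have h2 : morreyTerm q φ x j m ≤ C * L ^ (1 / p) := by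
          simpa only [hxL] using hC x hxs j m
        calc morreyTerm q φ (y + x) j m = morreyTerm q φ (yi + (yo + x)) j m := by
              rw [← add_assoc, ← hyio]
          _ ≤ A * (morreyTerm q φ yi j m + A * (morreyTerm q φ yo j m + morreyTerm q φ x j m)) := by
              refine (morreyTerm_add_le_of_nonneg hq hφ _ _ j m).trans ?_
              gcongr
              exact morreyTerm_add_le_of_nonneg hq hφ _ _ j m
          _ ≤ K := by
              rw [hK]
              have := hF j m hQ
              gcongr

end GlidingHump

/-! ### Strict singularity of the embedding -/

section StrictSingularity

variable {d : ℕ} {p₁ p₂ : ℝ} {φ₁ φ₂ : ℝ → ℝ}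

theorem morreySpaceNorm_inclusion (hp₁ : 0 < p₁) (hp₂ : 0 < p₂)
    (hle : (morreySpace hp₁ φ₁ : Submodule ℂ ((Fin d → ℤ) → ℂ)) ≤ morreySpace hp₂ φ₂)
    (x : (morreySpace hp₁ φ₁ : Submodule ℂ ((Fin d → ℤ) → ℂ))) :
    morreySpaceNorm hp₂ φ₂ (Submodule.inclusion hle x) = morreyNorm p₂ φ₂ x.1 := by
  rw [morreySpaceNorm, Submodule.coe_inclusion]

/-- Strict singularity may be tested on infinite-dimensional spaces of sequences, without
normalising the vectors: the strict inequality already forces `x ≠ 0`. -/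
theorem isStrictlySingular_inclusion (hp₁ : 0 < p₁) (hp₂ : 0 < p₂)
    (hφ₂ : ∀ j : ℕ, 0 ≤ φ₂ (2 ^ j))
    (hle : (morreySpace hp₁ φ₁ : Submodule ℂ ((Fin d → ℤ) → ℂ)) ≤ morreySpace hp₂ φ₂)
    (hb : IsBoundedOp (morreySpaceNorm hp₁ φ₁) (morreySpaceNorm hp₂ φ₂) (Submodule.inclusion hle))
    (h : ∀ Z : Submodule ℂ ((Fin d → ℤ) → ℂ), ¬ FiniteDimensional ℂ Z → Z ≤ morreySpace hp₁ φ₁ →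
      ∀ ε > 0, ∃ x ∈ Z, morreyNorm p₂ φ₂ x < ε * morreyNorm p₁ φ₁ x) :
    IsStrictlySingular (morreySpaceNorm hp₁ φ₁) (morreySpaceNorm hp₂ φ₂)
      (Submodule.inclusion hle) := by
  refine ⟨hb, fun Z hZ => ⟨?_, fun b hbl => ?_⟩⟩
  · rintro r ⟨x, -, -, rfl⟩
    exact morreyNorm_nonneg hφ₂ _
  · refine le_of_forall_pos_lt_add fun ε hε => ?_
    rw [zero_add]
    have hZ' : ¬ FiniteDimensional ℂ (Z.map (morreySpace hp₁ φ₁).subtype) := fun hfd =>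
      hZ (Module.Finite.equiv
        (Submodule.equivMapOfInjective _ (Submodule.injective_subtype _) Z).symm)
    obtain ⟨_, ⟨x, hxZ, rfl⟩, hx⟩ := h _ hZ' (Submodule.map_subtype_le _ _) ε hε
    rw [Submodule.subtype_apply] at hx
    have hpos : 0 < morreyNorm p₁ φ₁ (x : (Fin d → ℤ) → ℂ) :=
      pos_of_mul_pos_right ((morreyNorm_nonneg hφ₂ _).trans_lt hx) hε.le
    set N := morreyNorm p₁ φ₁ (x : (Fin d → ℤ) → ℂ) with hN
    have hc : ‖((N⁻¹ : ℝ) : ℂ)‖ = N⁻¹ := by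
      rw [Complex.norm_real, Real.norm_of_nonneg (inv_nonneg.2 hpos.le)]
    refine (hbl ⟨((N⁻¹ : ℝ) : ℂ) • x, Z.smul_mem _ hxZ, ?_, rfl⟩).trans_lt ?_
    · rw [morreySpaceNorm, Submodule.coe_smul, morreyNorm_smul hp₁, hc, ← hN,
        inv_mul_cancel₀ hpos.ne']
    · rw [morreySpaceNorm, Submodule.coe_inclusion, Submodule.coe_smul, morreyNorm_smul hp₂, hc,
        inv_mul_lt_iff₀ hpos, mul_comm N]
      exact hx

theorem not_finiteDimensional_of_single_mem {X : Submodule ℂ ((Fin d → ℤ) → ℂ)}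
    {Z : Submodule ℂ X} {U : Set (Fin d → ℤ)} (hU : U.Infinite)
    (h : ∀ k ∈ U, ∃ z ∈ Z, (z : (Fin d → ℤ) → ℂ) = Pi.single k 1) :
    ¬ FiniteDimensional ℂ Z := by
  intro hfd
  choose f hfZ hf using fun k : U => h k k.2
  have hli : LinearIndependent ℂ fun k : U => (⟨f k, hfZ k⟩ : Z) := by
    refine LinearIndependent.of_comp (X.subtype.comp Z.subtype) ?_
    have e : X.subtype.comp Z.subtype ∘ (fun k : U => (⟨f k, hfZ k⟩ : Z))
        = (fun k => Pi.single k 1) ∘ (Subtype.val : U → _) := funext hf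
    rw [e]
    exact (Pi.linearIndependent_single_one (Fin d → ℤ) ℂ).comp _ Subtype.val_injective
  exact hU (Set.finite_coe_iff.1 hli.finite)

/-- If `m_{φ₁,p₁} = ℓ_{p₁}` and the scaled weights of `φ₂` tend to zero, the gliding hump in
`m_{φ₂,p₂}` shows that the two quasi-norms are not equivalent on any infinite-dimensional
subspace. -/
theorem exists_morreyNorm_lt_of_tendsto_zero (hp₁ : 0 < p₁) (hp₂ : 0 < p₂)
    (hφ₁ : MemG d p₁ φ₁) (hφ₂ : MemG d p₂ φ₂) (hone₁ : φ₁ 1 = 1) {C : ℝ} (hC0 : 0 ≤ C)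
    (hC : ∀ a ∈ morreySpace (d := d) hp₁ φ₁,
      ∀ j m, morreyTerm p₂ φ₂ a j m ≤ C * morreyNorm p₁ φ₁ a)
    (hlim : Tendsto (scaledWeight d p₂ φ₂) atTop (𝓝 0)) (hLp : MorreyEqLp (d := d) hp₁ φ₁)
    {Z : Submodule ℂ ((Fin d → ℤ) → ℂ)} (hZ : ¬ FiniteDimensional ℂ Z)
    (hZle : Z ≤ morreySpace hp₁ φ₁) {ε : ℝ} (hε : 0 < ε) :
    ∃ x ∈ Z, morreyNorm p₂ φ₂ x < ε * morreyNorm p₁ φ₁ x := by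
  obtain ⟨hmem, c, _, hc, _, hcC⟩ := hLp
  obtain ⟨K, hK⟩ := exists_tsum_ge_morreyTerm_le hp₁ hp₂ (fun j => (hφ₂.1 j).le) hlim hC0
    (fun a ha j m => (hC a ((hmem a).2 ((memLp_ofReal_iff hp₁ a).2 ha)) j m).trans
      (mul_le_mul_of_nonneg_left (morreyNorm_le (morreyTerm_le_tsum hp₁ hφ₁ hone₁ ha)) hC0))
    hZ (fun x hx => (memLp_ofReal_iff hp₁ x).1 ((hmem x).1 (hZle hx)))
  have ht : Tendsto (fun t : ℝ => t ^ (1 / p₁)) atTop atTop :=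
    tendsto_rpow_atTop (one_div_pos.2 hp₁)
  obtain ⟨N, hN⟩ := eventually_atTop.1 (ht.eventually_gt_atTop (K / (ε * c)))
  obtain ⟨y, hyZ, hNy, hyK⟩ := hK N
  refine ⟨y, hyZ, (morreyNorm_le hyK).trans_lt ?_⟩
  have h1 := hN _ hNy
  rw [div_lt_iff₀ (by positivity)] at h1
  calc K < (∑' k, ‖y k‖ ^ p₁) ^ (1 / p₁) * (ε * c) := h1
    _ = ε * (c * (∑' k, ‖y k‖ ^ p₁) ^ (1 / p₁)) := by ring
    _ ≤ ε * morreyNorm p₁ φ₁ y := by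
      gcongr
      exact (hcC y (hZle hyZ)).1

theorem memG_one (hp : 0 < p₁) : MemG d p₁ fun _ => 1 := by
  refine ⟨fun _ => one_pos, fun j k hjk => ?_⟩
  have h : (j : ℝ) ≤ k := by exact_mod_cast hjk
  rw [div_one]
  refine ⟨le_rfl, Real.one_le_rpow one_le_two (mul_nonneg (sub_nonneg.2 h) (by positivity))⟩

theorem tendsto_scaledWeight_one (hd : 1 ≤ d) (hp : 0 < p₁) :
    Tendsto (scaledWeight d p₁ fun _ => 1) atTop (𝓝 0) := by
  have hd' : (0 : ℝ) < d := by exact_mod_cast hd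
  have h : scaledWeight d p₁ (fun _ => 1) = fun j : ℕ => ((2 : ℝ) ^ (-(d / p₁))) ^ j := by
    funext j
    rw [scaledWeight_eq, mul_one, ← Real.rpow_mul_natCast (by norm_num)]
    congr 1
    ring
  rw [h]
  exact tendsto_pow_atTop_nhds_zero_of_lt_one (by positivity)
    (Real.rpow_lt_one_of_one_lt_of_neg one_lt_two (neg_lt_zero.2 (div_pos hd' hp)))

/-- For `p₁ < p₂` the gliding hump is carried out in `m_{1,p₁}`, whose quasi-norm is the supremum
norm; interpolating between it and `ℓ_{p₁}` bounds the `ℓ_{p₂}`-quasi-norm. -/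
theorem exists_morreyNorm_lt_of_lt (hd : 1 ≤ d) (hp₁ : 0 < p₁) (hlt : p₁ < p₂)
    (hφ₂ : MemG d p₂ φ₂) (hone₂ : φ₂ 1 = 1) (hLp : MorreyEqLp (d := d) hp₁ φ₁)
    {Z : Submodule ℂ ((Fin d → ℤ) → ℂ)} (hZ : ¬ FiniteDimensional ℂ Z)
    (hZle : Z ≤ morreySpace hp₁ φ₁) {ε : ℝ} (hε : 0 < ε) :
    ∃ x ∈ Z, morreyNorm p₂ φ₂ x < ε * morreyNorm p₁ φ₁ x := by
  have hp₂ : 0 < p₂ := hp₁.trans hlt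
  obtain ⟨hmem, c, _, hc, _, hcC⟩ := hLp
  have hsum : ∀ x ∈ Z, Summable fun k => ‖x k‖ ^ p₁ := fun x hx =>
    (memLp_ofReal_iff hp₁ x).1 ((hmem x).1 (hZle hx))
  obtain ⟨K, hK⟩ := exists_tsum_ge_morreyTerm_le hp₁ hp₁ (fun _ => zero_le_one)
    (tendsto_scaledWeight_one hd hp₁) zero_le_one
    (fun a ha j m => by
      rw [one_mul]
      exact morreyTerm_le_tsum hp₁ (memG_one hp₁) rfl ha j m) hZ hsum
  have hr : 0 < 1 / p₁ - 1 / p₂ := sub_pos.2 (one_div_lt_one_div_of_lt hp₁ hlt)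
  have ht : Tendsto (fun t : ℝ => t ^ (1 / p₁ - 1 / p₂)) atTop atTop := tendsto_rpow_atTop hr
  obtain ⟨N, hN⟩ := eventually_atTop.1
    (ht.eventually_gt_atTop ((K ^ (p₂ - p₁)) ^ (1 / p₂) / (ε * c)))
  obtain ⟨y, hyZ, hNy, hyK⟩ := hK (max N 1)
  have hys := hsum y hyZ
  have hyK' : ∀ k, ‖y k‖ ≤ K := fun k => by
    rw [← morreyTerm_zero (φ := fun _ => 1) hp₁ rfl y k]
    exact hyK 0 k
  have hK0 : 0 ≤ K := (norm_nonneg _).trans (hyK' 0)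
  have hys₂ : Summable fun k => ‖y k‖ ^ p₂ :=
    (hys.mul_left (K ^ (p₂ - p₁))).of_nonneg_of_le (fun _ => by positivity)
      fun k => norm_rpow_le_of_norm_le hp₁ hlt.le (hyK' k)
  have hS₂ : ∑' k, ‖y k‖ ^ p₂ ≤ K ^ (p₂ - p₁) * ∑' k, ‖y k‖ ^ p₁ := by
    rw [← tsum_mul_left]
    exact hys₂.tsum_le_tsum (fun k => norm_rpow_le_of_norm_le hp₁ hlt.le (hyK' k))
      (hys.mul_left _)
  refine ⟨y, hyZ, (morreyNorm_le (morreyTerm_le_tsum hp₂ hφ₂ hone₂ hys₂)).trans_lt ?_⟩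
  have h1 := hN _ ((le_max_left _ _).trans hNy)
  have hcy := (hcC y (hZle hyZ)).1
  set S := ∑' k, ‖y k‖ ^ p₁ with hS
  have hS0 : 0 < S := one_pos.trans_le ((le_max_right _ _).trans hNy)
  rw [div_lt_iff₀ (by positivity)] at h1
  calc (∑' k, ‖y k‖ ^ p₂) ^ (1 / p₂) ≤ (K ^ (p₂ - p₁) * S) ^ (1 / p₂) :=
        Real.rpow_le_rpow (tsum_nonneg fun _ => by positivity) hS₂ (by positivity)
    _ = (K ^ (p₂ - p₁)) ^ (1 / p₂) * S ^ (1 / p₂) := Real.mul_rpow (by positivity) hS0.le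
    _ < S ^ (1 / p₁ - 1 / p₂) * (ε * c) * S ^ (1 / p₂) := by gcongr
    _ = ε * (c * (S ^ (1 / p₁ - 1 / p₂) * S ^ (1 / p₂))) := by ring
    _ = ε * (c * S ^ (1 / p₁)) := by rw [← Real.rpow_add hS0, sub_add_cancel]
    _ ≤ ε * morreyNorm p₁ φ₁ y := by gcongr

/-- If the scaled weights of `φ₁` tend to zero, `m_{φ₁,p₁}` contains a copy of `ℓ_∞`; on it the
quasi-norm of `m_{φ₁,p₁}` is at most a multiple of the supremum norm, which in turn is at most the
quasi-norm of `m_{φ₂,p₂}`. -/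
theorem not_isStrictlySingular_of_tendsto_zero (hd : 1 ≤ d) (hp₁ : 0 < p₁) (hp₂ : 0 < p₂)
    (hφ₁ : MemG d p₁ φ₁) (hone₁ : φ₁ 1 = 1) (hone₂ : φ₂ 1 = 1)
    (hlim : Tendsto (scaledWeight d p₁ φ₁) atTop (𝓝 0))
    (hle : (morreySpace hp₁ φ₁ : Submodule ℂ ((Fin d → ℤ) → ℂ)) ≤ morreySpace hp₂ φ₂) :
    ¬ IsStrictlySingular (morreySpaceNorm hp₁ φ₁) (morreySpaceNorm hp₂ φ₂)
      (Submodule.inclusion hle) := by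
  rintro ⟨-, hss⟩
  obtain ⟨U, K, hU, hK0, hK⟩ := exists_infinite_morreyTerm_le hp₁ hφ₁ hone₁ hd hlim
  have hglb := hss ((Submodule.pi Uᶜ fun _ => (⊥ : Submodule ℂ ℂ)).comap
    (morreySpace hp₁ φ₁).subtype) <| by
      refine not_finiteDimensional_of_single_mem hU fun k hk => ?_
      have hzero : ∀ l ∉ U, (Pi.single k 1 : (Fin d → ℤ) → ℂ) l = 0 := fun l hl =>
        Pi.single_eq_of_ne (by rintro rfl; exact hl hk) _
      refine ⟨⟨Pi.single k 1, mem_morreySpace_of_le hp₁ (hK _ 1 hzero fun l => ?_)⟩, ?_, rfl⟩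
      · rcases eq_or_ne l k with rfl | hlk
        · simp
        · simp [hlk]
      · exact fun l hl => (Submodule.mem_bot ℂ).2 (hzero l hl)
  have hlow : 1 / K ≤ 0 := by
    refine hglb.2 ?_
    rintro _ ⟨x, hxZ, hx1, rfl⟩
    rw [morreySpaceNorm_inclusion, div_le_iff₀ hK0]
    refine hx1.symm.trans_le (morreyNorm_le (hK _ _ (fun k hk => ?_) fun k => ?_))
    · exact (Submodule.mem_bot ℂ).1 (hxZ k hk)
    · exact norm_le_morreyNorm hp₂ hone₂ (hle x.2) k
  exact hlow.not_gt (by positivity)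

/-- For equal exponents and positive limits both spaces are `ℓ_p`, and the embedding is an
isomorphism. -/
theorem not_isStrictlySingular_of_eq (hd : 1 ≤ d) {p : ℝ} (hp : 0 < p)
    (h₁ : MorreyEqLp (d := d) hp φ₁) (h₂ : MorreyEqLp (d := d) hp φ₂)
    (hle : (morreySpace hp φ₁ : Submodule ℂ ((Fin d → ℤ) → ℂ)) ≤ morreySpace hp φ₂) :
    ¬ IsStrictlySingular (morreySpaceNorm hp φ₁) (morreySpaceNorm hp φ₂)
      (Submodule.inclusion hle) := by
  rintro ⟨-, hss⟩
  obtain ⟨hmem, _, C, _, hC, hC₁⟩ := h₁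
  obtain ⟨-, c, _, hc, _, hc₂⟩ := h₂
  have : Nonempty (Fin d) := ⟨⟨0, hd⟩⟩
  have hglb := hss ⊤ <| not_finiteDimensional_of_single_mem Set.infinite_univ fun k _ => by
    refine ⟨⟨Pi.single k 1, (hmem _).2 ((memLp_ofReal_iff hp _).2 ?_)⟩, trivial, rfl⟩
    refine summable_of_ne_finset_zero (s := {k}) fun l hl => ?_
    rw [Pi.single_eq_of_ne (by simpa using hl), norm_zero, Real.zero_rpow hp.ne']
  have hlow : c / C ≤ 0 := by
    refine hglb.2 ?_
    rintro _ ⟨x, -, hx1, rfl⟩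
    have h1 : 1 ≤ C * (∑' k, ‖x.1 k‖ ^ p) ^ (1 / p) := hx1.symm.trans_le (hC₁ x.1 x.2).2
    have h2 : c * (∑' k, ‖x.1 k‖ ^ p) ^ (1 / p) ≤ morreyNorm p φ₂ x.1 := (hc₂ x.1 (hle x.2)).1
    rw [morreySpaceNorm_inclusion, div_le_iff₀ hC]
    refine le_trans ?_ (mul_le_mul_of_nonneg_right h2 hC.le)
    rw [mul_assoc, mul_comm _ C]
    exact le_mul_of_one_le_right hc.le h1
  exact hlow.not_gt (by positivity)

theorem apply_two_pow_eq (p : ℝ) (φ : ℝ → ℝ) (j : ℕ) :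
    φ (2 ^ j) = scaledWeight d p φ j * (2 : ℝ) ^ ((j : ℝ) * (d / p)) := by
  rw [scaledWeight, cubeVolume_rpow, div_mul_cancel₀ _ (by positivity)]

/-- If `φ₂` grows like `2^{νd/p₂}`, the embedding condition forces `p₁ ≤ p₂` and makes `φ₁` grow
like `2^{νd/p₁}`. -/
theorem le_and_exists_le_scaledWeight (hd : 1 ≤ d) (hp₁ : 0 < p₁) (hp₂ : 0 < p₂)
    (hφ₁ : MemG d p₁ φ₁) (hone₁ : φ₁ 1 = 1) {C : ℝ} (hC0 : 0 < C)
    (hC : ∀ j : ℕ, φ₂ (2 ^ j) ≤ C * φ₁ (2 ^ j) ^ min 1 (p₁ / p₂)) {c : ℝ} (hc : 0 < c)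
    (hw : ∀ j, c ≤ scaledWeight d p₂ φ₂ j) :
    p₁ ≤ p₂ ∧ ∃ c > 0, ∀ j, c ≤ scaledWeight d p₁ φ₁ j := by
  have hd' : (0 : ℝ) < d := by exact_mod_cast hd
  have hlow : ∀ j : ℕ, c * (2 : ℝ) ^ ((j : ℝ) * (d / p₂))
      ≤ C * (scaledWeight d p₁ φ₁ j * (2 : ℝ) ^ ((j : ℝ) * (d / p₁))) ^ min 1 (p₁ / p₂) :=
    fun j => by
      rw [← apply_two_pow_eq p₁ φ₁ j]
      refine le_trans ?_ (hC j)
      rw [apply_two_pow_eq (d := d) p₂ φ₂ j]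
      exact mul_le_mul_of_nonneg_right (hw j) (by positivity)
  have hle : p₁ ≤ p₂ := by
    by_contra! hlt
    -- Otherwise `2^{jd/p₂} ≲ φ₂(2^j) ≲ φ₁(2^j) ≤ 2^{jd/p₁}` with `d/p₁ < d/p₂`.
    have hbound : ∀ j : ℕ, c / C ≤ ((2 : ℝ) ^ (d / p₁ - d / p₂)) ^ j := fun j => by
      have h := hlow j
      rw [min_eq_left ((one_le_div hp₂).2 hlt.le), Real.rpow_one] at h
      rw [div_le_iff₀' hC0, ← Real.rpow_mul_natCast (by norm_num), mul_comm _ (j : ℝ), mul_sub,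
        Real.rpow_sub (by norm_num), mul_div_assoc', le_div_iff₀ (by positivity)]
      refine h.trans (mul_le_mul_of_nonneg_left ?_ hC0.le)
      exact mul_le_of_le_one_left (by positivity) (scaledWeight_le_one hφ₁ hone₁ j)
    have ht : Tendsto (fun j : ℕ => ((2 : ℝ) ^ (d / p₁ - d / p₂)) ^ j) atTop (𝓝 0) :=
      tendsto_pow_atTop_nhds_zero_of_lt_one (by positivity)
        (Real.rpow_lt_one_of_one_lt_of_neg one_lt_two
          (sub_neg.2 (div_lt_div_of_pos_left hd' hp₂ hlt)))
    exact (ge_of_tendsto' ht hbound).not_gt (by positivity)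
  refine ⟨hle, (c / C) ^ (p₂ / p₁), by positivity, fun j => ?_⟩
  have h := hlow j
  have hw₁ := (scaledWeight_pos hφ₁ j).le
  have e : ((2 : ℝ) ^ ((j : ℝ) * (d / p₁))) ^ (p₁ / p₂) = (2 : ℝ) ^ ((j : ℝ) * (d / p₂)) := by
    rw [← Real.rpow_mul (by norm_num)]
    congr 1
    field_simp
  rw [min_eq_right ((div_le_one hp₂).2 hle), Real.mul_rpow hw₁ (by positivity), e, ← mul_assoc,
    mul_le_mul_iff_left₀ (by positivity), ← div_le_iff₀' hC0] at h
  have h' := Real.rpow_le_rpow (by positivity) h (div_pos hp₂ hp₁).le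
  rwa [← Real.rpow_mul hw₁, div_mul_div_cancel₀ hp₂.ne', div_self hp₁.ne', Real.rpow_one] at h'

end StrictSingularity

theorem mainTheorem2 {d : ℕ} (hd : 1 ≤ d) {p₁ p₂ : ℝ} (hp₁ : 0 < p₁) (hp₂ : 0 < p₂)
    (φ₁ φ₂ : ℝ → ℝ) (hφ₁ : MemG d p₁ φ₁) (hφ₂ : MemG d p₂ φ₂)
    (hone₁ : φ₁ 1 = 1) (hone₂ : φ₂ 1 = 1)
    (hsup₁ : ¬ BddAbove (Set.range fun j : ℕ => φ₁ (2 ^ j)))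
    (hsup₂ : ¬ BddAbove (Set.range fun j : ℕ => φ₂ (2 ^ j)))
    (hcont : BddAbove (Set.range fun j : ℕ => φ₂ (2 ^ j) / φ₁ (2 ^ j) ^ min 1 (p₁ / p₂))) :
    -- the limits are positive if, and only if, `m_{φ_i,p_i} = ℓ_{p_i}`
    ((∃ c > 0, ScaledLimit d p₁ φ₁ c) ↔ MorreyEqLp (d := d) hp₁ φ₁) ∧
    ((∃ c > 0, ScaledLimit d p₂ φ₂ c) ↔ MorreyEqLp (d := d) hp₂ φ₂) ∧
    -- the continuous embedding `id : m_{φ₁,p₁} → m_{φ₂,p₂}`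
    ∃ hle : (morreySpace hp₁ φ₁ : Submodule ℂ ((Fin d → ℤ) → ℂ)) ≤ morreySpace hp₂ φ₂,
      IsBoundedOp (morreySpaceNorm hp₁ φ₁) (morreySpaceNorm hp₂ φ₂) (Submodule.inclusion hle) ∧
      -- (i)
      (ScaledLimit d p₂ φ₂ 0 →
        ((p₁ = p₂ ∧ ENNReal.ofReal p₂ = rIndex d φ₂ → 1 ≤ p₁ ∧ 1 ≤ p₂) →
          (∃ c > 0, ScaledLimit d p₁ φ₁ c) →
          IsStrictlySingular (morreySpaceNorm hp₁ φ₁) (morreySpaceNorm hp₂ φ₂)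
            (Submodule.inclusion hle)) ∧
        (IsStrictlySingular (morreySpaceNorm hp₁ φ₁) (morreySpaceNorm hp₂ φ₂)
            (Submodule.inclusion hle) →
          ∃ c > 0, ScaledLimit d p₁ φ₁ c)) ∧
      -- (ii)
      ((∃ c > 0, ScaledLimit d p₂ φ₂ c) →
        (IsStrictlySingular (morreySpaceNorm hp₁ φ₁) (morreySpaceNorm hp₂ φ₂)
            (Submodule.inclusion hle) ↔
          (∃ c > 0, ScaledLimit d p₁ φ₁ c) ∧ p₁ < p₂)) := by
  obtain ⟨C, hCr⟩ := hcont
  have hC : ∀ j : ℕ, φ₂ (2 ^ j) ≤ C * φ₁ (2 ^ j) ^ min 1 (p₁ / p₂) := fun j => by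
    rw [← div_le_iff₀ (Real.rpow_pos_of_pos (hφ₁.1 j) _)]
    exact hCr ⟨j, rfl⟩
  have hC0 : 0 < C := pos_of_mul_pos_left ((hφ₂.1 0).trans_le (hC 0))
    (Real.rpow_nonneg (hφ₁.1 0).le _)
  have hterm : ∀ a ∈ morreySpace (d := d) hp₁ φ₁,
      ∀ j m, morreyTerm p₂ φ₂ a j m ≤ C * morreyNorm p₁ φ₁ a := fun a ha =>
    morreyTerm_le_mul_morreyNorm hp₁ hp₂ hφ₁ hφ₂ hone₁ hC ha
  have hnn₂ : ∀ j : ℕ, 0 ≤ φ₂ (2 ^ j) := fun j => (hφ₂.1 j).le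
  have hle : (morreySpace hp₁ φ₁ : Submodule ℂ ((Fin d → ℤ) → ℂ)) ≤ morreySpace hp₂ φ₂ :=
    fun a ha => mem_morreySpace_of_le hp₂ (hterm a ha)
  have hb : IsBoundedOp (morreySpaceNorm hp₁ φ₁) (morreySpaceNorm hp₂ φ₂)
      (Submodule.inclusion hle) := by
    refine ⟨C, fun x => ?_⟩
    rw [morreySpaceNorm_inclusion]
    exact morreyNorm_le (hterm x x.2)
  have hiff₁ := morreyEqLp_iff hp₁ hφ₁ hone₁ hd
  have hiff₂ := morreyEqLp_iff hp₂ hφ₂ hone₂ hd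
  have hss : IsStrictlySingular (morreySpaceNorm hp₁ φ₁) (morreySpaceNorm hp₂ φ₂)
      (Submodule.inclusion hle) → ∃ c > 0, ScaledLimit d p₁ φ₁ c := fun h =>
    (scaledLimit_pos_or_zero hφ₁).resolve_right fun h0 =>
      not_isStrictlySingular_of_tendsto_zero hd hp₁ hp₂ hφ₁ hone₁ hone₂
        ((scaledLimit_iff ..).1 h0) hle h
  refine ⟨hiff₁, hiff₂, hle, hb, fun hlim₂ => ⟨fun _ hlim₁ => ?_, hss⟩,
    fun hlim₂ => ⟨fun h => ?_, ?_⟩⟩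
  · exact isStrictlySingular_inclusion hp₁ hp₂ hnn₂ hle hb fun Z hZ hZle ε hε =>
      exists_morreyNorm_lt_of_tendsto_zero hp₁ hp₂ hφ₁ hφ₂ hone₁ hC0.le hterm
        ((scaledLimit_iff ..).1 hlim₂) (hiff₁.1 hlim₁) hZ hZle hε
  · have hlim₁ := hss h
    refine ⟨hlim₁, ?_⟩
    obtain ⟨c, hc, hw⟩ := (exists_scaledLimit_pos_iff hφ₂).1 hlim₂
    refine (le_and_exists_le_scaledWeight hd hp₁ hp₂ hφ₁ hone₁ hC0 hC hc hw).1.lt_of_ne ?_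
    rintro rfl
    exact not_isStrictlySingular_of_eq hd hp₁ (hiff₁.1 hlim₁) (hiff₂.1 hlim₂) hle h
  · rintro ⟨hlim₁, hlt⟩
    exact isStrictlySingular_inclusion hp₁ hp₂ hnn₂ hle hb fun Z hZ hZle ε hε =>
      exists_morreyNorm_lt_of_lt hd hp₁ hlt hφ₂ hone₂ (hiff₁.1 hlim₁) hZ hZle hε
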